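/- Theorem. A pair of $(0,1)$ matrices $A\neq B$ of the same size with $AA^T=BB^T$ and $A^TA=B^TB$ is called a pair of Gram mates. A $(0,1,-1)$ matrix $E$ all of whose row sums and column sums are zero is called realizable if there is a $(0,1)$ matrix $A$ such that $A$ and $A+E$ are Gram mates. Let $a,b,c,d,e,f,k,l,p,q,r,s$ be nonnegative integers such that $a+b$, $c+d$, $e+f$, $k+l$, $p+q$ and $r+s$ are positive, and let $$E=\begin{bmatrix} J_{k,a} & -J_{k,b} & J_{k,c} & -J_{k,d} & 0 & 0 \\ -J_{l,a} & J_{l,b} & -J_{l,c} & J_{l,d} & 0 & 0 \\ J_{p,a} & -J_{p,b} & 0 & 0 & J_{p,e} & -J_{p,f} \\ -J_{q,a} & J_{q,b} & 0 & 0 & -J_{q,e} & J_{q,f} \\ 0 & 0 & J_{r,c} & -J_{r,d} & -J_{r,e} & J_{r,f} \\ 0 & 0 & -J_{s,c} & J_{s,d} & J_{s,e} & -J_{s,f} \end{bmatrix},$$ where $J_{m,n}$ denotes the $m\times n$ all ones matrix (blocks with an index $0$ are absent). Assume that every row sum and every column sum of $E$ is zero. Then $E$ is realizable if and only if one of the following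 conditions holds: (i) $a+b$, $c+d$, $e+f$, $k+l$, $p+q$ and $r+s$ are all even; (ii) $a+b$, $c+d$ and $e+f$ are all odd, or $k+l$, $p+q$ and $r+s$ are all odd; and, moreover, $\frac{e+f}{k+l}=\frac{c+d}{p+q}=\frac{a+b}{r+s}$. -/

import Mathlib

open scoped Matrix

/-- A matrix all of whose entries are `0` or `1`. -/
def IsZeroOneMatrix {m n : Type*} (A : Matrix m n ℤ) : Prop :=
  ∀ i j, A i j = 0 ∨ A i j = 1

/-- `A` and `B` are Gram mates: distinct `(0,1)` matrices of the same size with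
`A Aᵀ = B Bᵀ` and `Aᵀ A = Bᵀ B`. -/
def AreGramMates {m n : Type*} [Fintype m] [Fintype n] (A B : Matrix m n ℤ) : Prop :=
  IsZeroOneMatrix A ∧ IsZeroOneMatrix B ∧ A * Aᵀ = B * Bᵀ ∧ Aᵀ * A = Bᵀ * B ∧ A ≠ B

/-- `E` is realizable (with respect to Gram mates): there is a pair of Gram mates `A` and `A + E`.
The notion is used for `(0,1,-1)` matrices `E` with zero row sums and zero column sums. -/
def IsRealizable {m n : Type*} [Fintype m] [Fintype n] (E : Matrix m n ℤ) : Prop :=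
  ∃ A : Matrix m n ℤ, AreGramMates A (A + E)

/-- The index set of six consecutive blocks of sizes `w 0, …, w 5`: the pair `⟨i, t⟩` is the
`t`-th index of the `i`-th block. Blocks of size `0` are allowed. -/
abbrev BlockIndex (w : Fin 6 → ℕ) : Type := Σ i : Fin 6, Fin (w i)

/-- The sign pattern of the blocks of a matrix of form (M5). -/
def signPatternM5 : Matrix (Fin 6) (Fin 6) ℤ :=
  !![ 1, -1,  1, -1,  0,  0;
     -1,  1, -1,  1,  0,  0;
      1, -1,  0,  0,  1, -1;
     -1,  1,  0,  0, -1,  1;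
      0,  0,  1, -1, -1,  1;
      0,  0, -1,  1,  1, -1]

/-- The block matrix of form (M5) with row blocks of sizes `k, l, p, q, r, s` and column blocks of
sizes `a, b, c, d, e, f`: its `(i, j)` block is the all ones matrix `J`, its negative `-J`, or the
zero matrix, according to the `(i, j)` entry of the sign pattern. -/
def matrixM5 (k l p q r s a b c d e f : ℕ) :
    Matrix (BlockIndex ![k, l, p, q, r, s]) (BlockIndex ![a, b, c, d, e, f]) ℤ :=
  Matrix.of fun x y => signPatternM5 x.1 y.1

/-! Up to row signs `u` and column signs `v`, `E` is a 3×3 block pattern with zeros on the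
antidiagonal. Put `F = 2A + E - J`. If `A` and `A + E` are (0,1), then `F` vanishes where `E ≠ 0`
and is ±1 on the three zero blocks. Zero line sums of `E` kill the `J` terms, so the Gram conditions
say that `F Eᵀ` and `Fᵀ E` are skew-symmetric. After absorbing signs, this means that the zero
blocks carry sign matrices with one common row sum `x` and one common column sum `y`
(`isRealizable_iff_exists_isSignBlock`).

The blocks have sizes K×Z, P×Y, R×X, with K, P, R = k+l, p+q, r+s and X, Y, Z = a+b, c+d, e+f.
Parity of sums of signs and the double count K x = Z y give necessity. Conversely, checkerboards
realize `x = y = 0` when all sizes are even, and inflated circulants of odd order realize the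
proportional case. -/

/-- The pattern of signs of the three by three coarse blocks of a matrix of form (M5). -/
def coarsePattern : Fin 3 → Fin 3 → ℤ := ![![1, 1, 0], ![1, 0, 1], ![0, 1, -1]]

/-- Signs of the coarse blocks which turn `coarsePattern` into a skew-symmetric matrix. -/
def coarseSign : Fin 3 → ℤ := ![1, -1, 1]

theorem coarsePattern_symm (r t : Fin 3) : coarsePattern r t = coarsePattern t r := by
  revert r t; decide

theorem coarsePattern_eq_zero_iff (r t : Fin 3) : coarsePattern r t = 0 ↔ t = r.rev := by
  revert r t; decide

theorem coarsePattern_values (r t : Fin 3) (h : t ≠ r.rev) :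
    coarsePattern r t = 1 ∨ coarsePattern r t = -1 := by
  revert r t; decide

theorem coarseSign_mul_self (r : Fin 3) : coarseSign r * coarseSign r = 1 := by
  revert r; decide

/-- Lets rows and columns use the same normalizing sign on each zero block. -/
theorem coarseSign_rev (r : Fin 3) : coarseSign r.rev = coarseSign r := by
  revert r; decide

/-- Reversing one index moves the zeros to the diagonal; the signs then make the pattern skew. This
turns skewness of `F Eᵀ` into equality of row sums. -/
theorem coarseSign_mul_coarsePattern (r t : Fin 3) :
    coarseSign r * coarsePattern t r.rev = -(coarseSign t * coarsePattern r t.rev) := by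
  revert r t; decide

theorem sign_mul_sign {x y : ℤ} (hx : x = 1 ∨ x = -1) (hy : y = 1 ∨ y = -1) :
    x * y = 1 ∨ x * y = -1 := by
  rcases hx with rfl | rfl <;> rcases hy with rfl | rfl <;> norm_num

theorem mul_self_of_sign {x : ℤ} (hx : x = 1 ∨ x = -1) : x * x = 1 := by
  rcases hx with rfl | rfl <;> norm_num

theorem coarseSign_values (r : Fin 3) : coarseSign r = 1 ∨ coarseSign r = -1 := by
  revert r; decide

/-! ### Gram conditions as skew-symmetry -/

section Skew

variable {m n : Type*} [Fintype n]

/-- For a matrix `E` with coarse blocks `± u vᵀ` and a matrix `F` supported on the zero blocks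
of `E`, skew-symmetry of `F Eᵀ` means that the signed row sums of `F` are constant. -/
theorem skew_iff_rowSums_const {ρ : m → Fin 3} {σ : n → Fin 3} {u : m → ℤ} {v : n → ℤ}
    {E F : Matrix m n ℤ} (hρ : Function.Surjective ρ) (hu : ∀ i, u i = 1 ∨ u i = -1)
    (hE : ∀ i j, E i j = u i * v j * coarsePattern (ρ i) (σ j))
    (hF : ∀ i j, σ j ≠ (ρ i).rev → F i j = 0) :
    F * Eᵀ + E * Fᵀ = 0 ↔
      ∃ c : ℤ, ∀ i, ∑ j, coarseSign (ρ i) * (u i * v j) * F i j = c := by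
  have entry (i i' : m) : ∑ j, F i j * E i' j =
      (u i * u i') * ((coarseSign (ρ i) * coarsePattern (ρ i') (ρ i).rev) *
        ∑ j, coarseSign (ρ i) * (u i * v j) * F i j) := by
    rw [Finset.mul_sum, Finset.mul_sum]
    refine Finset.sum_congr rfl fun j _ => ?_
    by_cases h : σ j = (ρ i).rev
    · rw [hE, h]
      linear_combination (-(F i j * u i' * v j * coarsePattern (ρ i') (ρ i).rev)) *
        (coarseSign (ρ i) * coarseSign (ρ i) * mul_self_of_sign (hu i) +
          coarseSign_mul_self (ρ i))
    · rw [hF i j h]; ring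
  have skew (i i' : m) : (F * Eᵀ + E * Fᵀ) i i' =
      (u i * u i') * ((coarseSign (ρ i) * coarsePattern (ρ i') (ρ i).rev) *
        ((∑ j, coarseSign (ρ i) * (u i * v j) * F i j) -
          ∑ j, coarseSign (ρ i') * (u i' * v j) * F i' j)) := by
    have h := entry i' i
    simp only [mul_comm (F i' _)] at h
    simp only [Matrix.add_apply, Matrix.mul_apply, Matrix.transpose_apply]
    rw [entry i i', h]
    linear_combination (-(u i * u i') * ∑ j, coarseSign (ρ i') * (u i' * v j) * F i' j) *
      (-coarseSign_mul_coarsePattern (ρ i) (ρ i'))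
  constructor
  · intro h
    have key (i i' : m) (hne : ρ i ≠ ρ i') :
        ∑ j, coarseSign (ρ i) * (u i * v j) * F i j =
          ∑ j, coarseSign (ρ i') * (u i' * v j) * F i' j := by
      have h0 := skew i i'
      rw [h, Matrix.zero_apply, eq_comm] at h0
      have hu0 (i : m) : u i ≠ 0 := by rcases hu i with h | h <;> simp [h]
      have hs : coarseSign (ρ i) ≠ 0 := by
        rcases coarseSign_values (ρ i) with h | h <;> simp [h]
      have ht : coarsePattern (ρ i') (ρ i).rev ≠ 0 := fun h1 =>
        hne (Fin.rev_injective ((coarsePattern_eq_zero_iff _ _).1 h1))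
      simpa [hu0, hs, ht, sub_eq_zero] using h0
    obtain ⟨i₀, h₀⟩ := hρ 0
    obtain ⟨i₁, h₁⟩ := hρ 1
    refine ⟨∑ j, coarseSign (ρ i₀) * (u i₀ * v j) * F i₀ j, fun i => ?_⟩
    -- Rows in the same coarse block are compared through a row of another block.
    by_cases hi : ρ i = 0
    · rw [key i i₁ (by rw [hi, h₁]; decide), key i₁ i₀ (by rw [h₀, h₁]; decide)]
    · exact key i i₀ (by rwa [h₀])
  · rintro ⟨c, hc⟩
    ext i i'
    rw [skew, hc, hc, sub_self, mul_zero, mul_zero, Matrix.zero_apply]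

/-- The Gram condition in terms of `2 A + E - J`, if the row sums of `E` vanish. -/
theorem gram_eq_iff_skew {A E : Matrix m n ℤ} (hrow : E *ᵥ 1 = 0) :
    A * Aᵀ = (A + E) * (A + E)ᵀ ↔
      (2 • A + E - Matrix.of fun _ _ => 1) * Eᵀ +
        E * (2 • A + E - Matrix.of fun _ _ => 1)ᵀ = 0 := by
  have h1 (i : m) : ∑ j, E i j = 0 := by
    simpa [Matrix.mulVec, dotProduct] using congrFun hrow i
  have hJ : (Matrix.of fun _ _ => 1 : Matrix m n ℤ) * Eᵀ = 0 := by
    ext i j; simp [Matrix.mul_apply, h1]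
  have hJ' : E * (Matrix.of fun _ _ => 1 : Matrix m n ℤ)ᵀ = 0 := by
    ext i j; simp [Matrix.mul_apply, h1]
  -- Without the `J` terms, both sides are twice `A Eᵀ + E Aᵀ + E Eᵀ`.
  have h2 : (2 • A + E - Matrix.of fun _ _ => 1) * Eᵀ +
        E * (2 • A + E - Matrix.of fun _ _ => 1)ᵀ =
      2 • ((A + E) * (A + E)ᵀ - A * Aᵀ) := by
    simp only [Matrix.transpose_sub, Matrix.transpose_add, Matrix.add_mul,
      Matrix.sub_mul, Matrix.mul_add, Matrix.mul_sub, hJ, hJ', two_smul]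
    abel
  rw [h2]
  constructor
  · intro h
    rw [h, sub_self, smul_zero]
  · intro h
    ext i j
    have h3 := congrFun (congrFun h i) j
    simp only [two_smul, Matrix.add_apply, Matrix.sub_apply, Matrix.zero_apply] at h3
    omega

end Skew

/-! ### Sign matrices with constant line sums -/

section SignMatrix

theorem neg_one_pow_values (t : ℕ) : (-1 : ℤ) ^ t = 1 ∨ (-1 : ℤ) ^ t = -1 :=
  neg_one_pow_eq_or ℤ t

theorem sum_fin_neg_one_pow (g : ℕ) :
    ∑ t : Fin g, (-1 : ℤ) ^ (t : ℕ) = if Even g then 0 else 1 := by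
  rw [Fin.sum_univ_eq_sum_range (fun t => (-1 : ℤ) ^ t)]
  exact neg_one_geom_sum

/-- A sign matrix on `S × T` with row sums `x` and column sums `y`. -/
def IsSignBlock {m n : Type*} (S : Finset m) (T : Finset n) (x y : ℤ) (G : m → n → ℤ) : Prop :=
  (∀ i ∈ S, ∀ j ∈ T, G i j = 1 ∨ G i j = -1) ∧
    (∀ i ∈ S, ∑ j ∈ T, G i j = x) ∧ ∀ j ∈ T, ∑ i ∈ S, G i j = y

variable {m n : Type*} {S : Finset m} {T : Finset n} {x y : ℤ}

theorem exists_isSignBlock_of_equiv {I J : Type*} [Fintype I] [Fintype J] (eS : S ≃ I)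
    (eT : T ≃ J) (H : I → J → ℤ) (hH : ∀ i j, H i j = 1 ∨ H i j = -1)
    (hx : ∀ i, ∑ j, H i j = x) (hy : ∀ j, ∑ i, H i j = y) :
    ∃ G, IsSignBlock S T x y G := by
  classical
  refine ⟨fun i j => if h : i ∈ S ∧ j ∈ T then H (eS ⟨i, h.1⟩) (eT ⟨j, h.2⟩) else 0,
    fun i hi j hj => ?_, fun i hi => ?_, fun j hj => ?_⟩
  · simpa [hi, hj] using hH _ _
  · rw [← hx (eS ⟨i, hi⟩), ← eT.sum_comp, ← Finset.sum_coe_sort]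
    exact Finset.sum_congr rfl fun j _ => by simp [hi]
  · rw [← hy (eT ⟨j, hj⟩), ← eS.sum_comp, ← Finset.sum_coe_sort]
    exact Finset.sum_congr rfl fun i _ => by simp [hj]

/-- A checkerboard works. -/
theorem exists_isSignBlock_zero (hS : Even S.card) (hT : Even T.card) :
    ∃ G, IsSignBlock S T 0 0 G := by
  refine exists_isSignBlock_of_equiv S.equivFin T.equivFin
    (fun i j => (-1) ^ (i : ℕ) * (-1) ^ (j : ℕ))
    (fun i j => sign_mul_sign (neg_one_pow_values _) (neg_one_pow_values _)) ?_ ?_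
  · intro i
    rw [← Finset.mul_sum, sum_fin_neg_one_pow, if_pos hT, mul_zero]
  · intro j
    rw [← Finset.sum_mul, sum_fin_neg_one_pow, if_pos hS, zero_mul]

/-- The circulant of odd order `g` built from 1, -1, …, 1 has all line sums 1; inflate each entry to
a constant `s × t` block. -/
theorem exists_isSignBlock_of_odd {g s t : ℕ} (hg : Odd g) (hS : S.card = g * s)
    (hT : T.card = g * t) : ∃ G, IsSignBlock S T t s G := by
  have : NeZero g := ⟨hg.pos.ne'⟩
  have hsum : ∑ z : Fin g, (-1 : ℤ) ^ (z : ℕ) = 1 := by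
    rw [sum_fin_neg_one_pow, if_neg (Nat.not_even_iff_odd.2 hg)]
  refine exists_isSignBlock_of_equiv
    ((S.equivFinOfCardEq hS).trans finProdFinEquiv.symm)
    ((T.equivFinOfCardEq hT).trans finProdFinEquiv.symm)
    (fun i j => (-1) ^ ((i.1 - j.1 : Fin g) : ℕ)) (fun i j => neg_one_pow_values _) ?_ ?_
  · intro i
    have h : ∑ z : Fin g, (-1 : ℤ) ^ ((i.1 - z : Fin g) : ℕ) = 1 := by
      refine Eq.trans ?_ hsum
      exact (Equiv.subLeft i.1).sum_comp fun z : Fin g => (-1 : ℤ) ^ (z : ℕ)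
    simp [Fintype.sum_prod_type, ← Finset.mul_sum, h]
  · intro j
    have h : ∑ z : Fin g, (-1 : ℤ) ^ ((z - j.1 : Fin g) : ℕ) = 1 := by
      refine Eq.trans ?_ hsum
      exact (Equiv.subRight j.1).sum_comp fun z : Fin g => (-1 : ℤ) ^ (z : ℕ)
    simp [Fintype.sum_prod_type, ← Finset.mul_sum, h]

theorem even_sum_signs_iff {T : Finset n} {f : n → ℤ} (hf : ∀ j ∈ T, f j = 1 ∨ f j = -1) :
    Even (∑ j ∈ T, f j) ↔ Even T.card := by
  have h : Even (∑ j ∈ T, (f j + 1)) := by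
    refine Finset.even_sum _ fun j hj => ?_
    rcases hf j hj with h | h <;> simp [h]
  rw [Finset.sum_add_distrib, Int.even_add] at h
  rw [h]
  simp

theorem IsSignBlock.even_row_iff {G : m → n → ℤ} (hG : IsSignBlock S T x y G)
    (hS : 0 < S.card) : Even x ↔ Even T.card := by
  obtain ⟨i, hi⟩ := Finset.card_pos.1 hS
  rw [← hG.2.1 i hi]
  exact even_sum_signs_iff (hG.1 i hi)

theorem IsSignBlock.even_col_iff {G : m → n → ℤ} (hG : IsSignBlock S T x y G)
    (hT : 0 < T.card) : Even y ↔ Even S.card := by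
  obtain ⟨j, hj⟩ := Finset.card_pos.1 hT
  rw [← hG.2.2 j hj]
  exact even_sum_signs_iff fun i hi => hG.1 i hi j hj

/-- Both sides count the sum of all entries. -/
theorem IsSignBlock.card_mul_eq {G : m → n → ℤ} (hG : IsSignBlock S T x y G) :
    (S.card : ℤ) * x = T.card * y := by
  have h := Finset.sum_comm (s := S) (t := T) (f := G)
  rw [Finset.sum_congr rfl hG.2.1, Finset.sum_congr rfl hG.2.2] at h
  simpa using h

end SignMatrix

/-! ### Reduction to the zero blocks -/

section Realizable

variable {m n : Type*} [Fintype m] [Fintype n] {ρ : m → Fin 3} {σ : n → Fin 3} {u : m → ℤ}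
  {v : n → ℤ} {E : Matrix m n ℤ}

/-- The second Gram condition is the first one for the transposes; the double transposes are kept so
that `skew_iff_rowSums_const` applies to `Eᵀ` directly. -/
theorem areGramMates_iff_of_ne_zero {A : Matrix m n ℤ} (hrow : E *ᵥ 1 = 0)
    (hcol : 1 ᵥ* E = 0) (hE0 : E ≠ 0) :
    AreGramMates A (A + E) ↔ IsZeroOneMatrix A ∧ IsZeroOneMatrix (A + E) ∧
      (2 • A + E - Matrix.of fun _ _ => 1) * Eᵀ +
        E * (2 • A + E - Matrix.of fun _ _ => 1)ᵀ = 0 ∧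
      (2 • A + E - Matrix.of fun _ _ => 1)ᵀ * Eᵀᵀ +
        Eᵀ * (2 • A + E - Matrix.of fun _ _ => 1)ᵀᵀ = 0 := by
  have hc : Eᵀ *ᵥ 1 = 0 := by rw [Matrix.mulVec_transpose, hcol]
  have h2 := gram_eq_iff_skew (A := Aᵀ) hc
  have hJ : (2 • Aᵀ + Eᵀ - Matrix.of fun _ _ => 1) =
      (2 • A + E - Matrix.of fun _ _ => 1)ᵀ := by
    ext i j; simp
  rw [hJ, ← Matrix.transpose_add, Matrix.transpose_transpose, Matrix.transpose_transpose] at h2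
  unfold AreGramMates
  rw [gram_eq_iff_skew hrow, h2, Matrix.transpose_transpose]
  simp [hE0]

/-- A matrix with the coarse blocks of form (M5) is realizable if and only if its zero blocks
admit sign matrices with common row sums and common column sums. -/
theorem isRealizable_iff_exists_isSignBlock (hρ : Function.Surjective ρ)
    (hσ : Function.Surjective σ) (hu : ∀ i, u i = 1 ∨ u i = -1) (hv : ∀ j, v j = 1 ∨ v j = -1)
    (hE : ∀ i j, E i j = u i * v j * coarsePattern (ρ i) (σ j))
    (hrow : E *ᵥ 1 = 0) (hcol : 1 ᵥ* E = 0) :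
    IsRealizable E ↔ ∃ x y : ℤ, ∀ r : Fin 3, ∃ G : m → n → ℤ,
      IsSignBlock {i | ρ i = r} {j | σ j = r.rev} x y G := by
  have hrev (i : m) (j : n) : ρ i ≠ (σ j).rev ↔ σ j ≠ (ρ i).rev := by
    rw [not_iff_not, eq_comm, Fin.rev_eq_iff]
  have hET (j : n) (i : m) : Eᵀ j i = v j * u i * coarsePattern (σ j) (ρ i) := by
    rw [Matrix.transpose_apply, hE, coarsePattern_symm]; ring
  have hw (i : m) (j : n) : coarseSign (ρ i) * (u i * v j) = 1 ∨
      coarseSign (ρ i) * (u i * v j) = -1 :=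
    sign_mul_sign (coarseSign_values _) (sign_mul_sign (hu i) (hv j))
  have hEz (i : m) (j : n) (h : σ j = (ρ i).rev) : E i j = 0 := by
    rw [hE, (coarsePattern_eq_zero_iff _ _).2 h, mul_zero]
  have hEs (i : m) (j : n) (h : σ j ≠ (ρ i).rev) : E i j = 1 ∨ E i j = -1 := by
    rw [hE]
    exact sign_mul_sign (sign_mul_sign (hu i) (hv j)) (coarsePattern_values _ _ h)
  have hE0 : E ≠ 0 := by
    obtain ⟨i, hi⟩ := hρ 0
    obtain ⟨j, hj⟩ := hσ 0
    rintro rfl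
    rcases hEs i j (by rw [hi, hj]; decide) with h | h <;> simp at h
  constructor
  · rintro ⟨A, hA⟩
    obtain ⟨hA, hB, h1, h2⟩ := (areGramMates_iff_of_ne_zero hrow hcol hE0).1 hA
    set F : Matrix m n ℤ := 2 • A + E - Matrix.of fun _ _ => 1 with hFdef
    have hFa (i : m) (j : n) : F i j = 2 * A i j + E i j - 1 := by simp [hFdef]
    -- A nonzero entry of `E` forces the entry of `A`: 0 where `E` is 1, and 1 where `E` is -1.
    have hF0 (i : m) (j : n) (h : σ j ≠ (ρ i).rev) : F i j = 0 := by
      have hb : A i j + E i j = 0 ∨ A i j + E i j = 1 := hB i j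
      rw [hFa]
      rcases hA i j with h1 | h1 <;> rcases hEs i j h with h2 | h2 <;> omega
    have hFs (i : m) (j : n) (h : σ j = (ρ i).rev) : F i j = 1 ∨ F i j = -1 := by
      rw [hFa, hEz i j h]
      rcases hA i j with h1 | h1 <;> omega
    obtain ⟨x, hx⟩ := (skew_iff_rowSums_const hρ hu hE hF0).1 h1
    obtain ⟨y, hy⟩ := (skew_iff_rowSums_const hσ hv hET
      (fun j i h => hF0 i j ((hrev i j).1 h))).1 h2
    refine ⟨x, y, fun r => ⟨fun i j => coarseSign (ρ i) * (u i * v j) * F i j, ?_, ?_, ?_⟩⟩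
    · intro i hi j hj
      simp only [Finset.mem_filter, Finset.mem_univ, true_and] at hi hj
      exact sign_mul_sign (hw i j) (hFs i j (by rw [hi, hj]))
    · intro i hi
      simp only [Finset.mem_filter, Finset.mem_univ, true_and] at hi
      rw [← hx i]
      refine Finset.sum_subset (Finset.filter_subset _ _) fun j _ hj => ?_
      beta_reduce
      rw [hF0 i j (by simpa [hi] using hj), mul_zero]
    · intro j hj
      simp only [Finset.mem_filter, Finset.mem_univ, true_and] at hj
      rw [← hy j]
      have h (i : m) (hi : i ∉ ({i | ρ i = r} : Finset m)) : F i j = 0 :=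
        hF0 i j fun h => hi (by simpa [hj, eq_comm] using h)
      rw [← Finset.sum_subset (Finset.subset_univ ({i | ρ i = r} : Finset m)) fun i _ hi => by
        rw [h i hi, mul_zero]]
      refine Finset.sum_congr rfl fun i hi => ?_
      simp only [Finset.mem_filter, Finset.mem_univ, true_and] at hi
      beta_reduce
      rw [hi, hj, coarseSign_rev, mul_comm (u i)]
  · rintro ⟨x, y, h⟩
    choose G hG using h
    let F : Matrix m n ℤ := fun i j =>
      if σ j = (ρ i).rev then coarseSign (ρ i) * (u i * v j) * G (ρ i) i j else 0
    have hF0 (i : m) (j : n) (h : σ j ≠ (ρ i).rev) : F i j = 0 := if_neg h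
    have hF1 (i : m) (j : n) (h : σ j = (ρ i).rev) :
        F i j = coarseSign (ρ i) * (u i * v j) * G (ρ i) i j := if_pos h
    have hFG (i : m) (j : n) (h : σ j = (ρ i).rev) :
        coarseSign (ρ i) * (u i * v j) * F i j = G (ρ i) i j := by
      rw [hF1 i j h, ← mul_assoc, mul_self_of_sign (hw i j), one_mul]
    have hFs (i : m) (j : n) (h : σ j = (ρ i).rev) : F i j = 1 ∨ F i j = -1 := by
      rw [hF1 i j h]
      exact sign_mul_sign (hw i j) ((hG (ρ i)).1 i (by simp) j (by simp [h]))
    have hEF (i : m) (j : n) : (E i j = 0 ∧ (F i j = 1 ∨ F i j = -1)) ∨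
        (F i j = 0 ∧ (E i j = 1 ∨ E i j = -1)) := by
      by_cases h : σ j = (ρ i).rev
      · exact Or.inl ⟨hEz i j h, hFs i j h⟩
      · exact Or.inr ⟨hF0 i j h, hEs i j h⟩
    -- Solves `F = 2A + E - J`; the numerator is always 0 or 2, so the division is exact.
    let A : Matrix m n ℤ := Matrix.of fun i j => (1 + F i j - E i j) / 2
    have hAa (i : m) (j : n) : A i j = (1 + F i j - E i j) / 2 := rfl
    have hF : 2 • A + E - Matrix.of (fun _ _ => 1) = F := by
      ext i j
      simp only [Matrix.sub_apply, Matrix.add_apply, Matrix.smul_apply, Matrix.of_apply, hAa]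
      rcases hEF i j with ⟨h, h' | h'⟩ | ⟨h, h' | h'⟩ <;> rw [h, h'] <;> norm_num
    refine ⟨A, (areGramMates_iff_of_ne_zero hrow hcol hE0).2 ⟨?_, ?_, ?_, ?_⟩⟩
    · intro i j
      rw [hAa]
      rcases hEF i j with ⟨h, h' | h'⟩ | ⟨h, h' | h'⟩ <;> rw [h, h'] <;> norm_num
    · intro i j
      rw [Matrix.add_apply, hAa]
      rcases hEF i j with ⟨h, h' | h'⟩ | ⟨h, h' | h'⟩ <;> rw [h, h'] <;> norm_num
    · rw [hF]
      refine (skew_iff_rowSums_const hρ hu hE hF0).2 ⟨x, fun i => ?_⟩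
      rw [← (hG (ρ i)).2.1 i (by simp),
        ← Finset.sum_subset (Finset.filter_subset (fun j => σ j = (ρ i).rev) _) fun j _ hj => by
          rw [hF0 i j (by simpa using hj), mul_zero]]
      exact Finset.sum_congr rfl fun j hj => hFG i j (by simpa using hj)
    · rw [hF]
      refine (skew_iff_rowSums_const hσ hv hET
        (fun j i h => hF0 i j ((hrev i j).1 h))).2 ⟨y, fun j => ?_⟩
      rw [← (hG (σ j).rev).2.2 j (by simp),
        ← Finset.sum_subset (Finset.filter_subset (fun i => ρ i = (σ j).rev) _) fun i _ hi => by
          rw [hF0 i j ((hrev i j).1 (by simpa using hi)), mul_zero]]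
      refine Finset.sum_congr rfl fun i hi => ?_
      have hi : ρ i = (σ j).rev := by simpa using hi
      rw [← hi, ← hFG i j (by rw [hi, Fin.rev_rev]), hi, coarseSign_rev,
        mul_comm (u i)]

end Realizable

/-! ### Proportional pairs -/

section Arithmetic

/-- Proportional pairs of positive integers, one of whose members is odd throughout, are odd
multiples of a common pair. -/
theorem exists_odd_multiples {K P R X Y Z : ℕ} (hK : 0 < K)
    (hodd : (Odd X ∧ Odd Y ∧ Odd Z) ∨ (Odd K ∧ Odd P ∧ Odd R))
    (h₁ : Z * P = Y * K) (h₂ : Z * R = X * K) :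
    ∃ s t : ℕ, (∃ g, Odd g ∧ K = g * s ∧ Z = g * t) ∧ (∃ g, Odd g ∧ P = g * s ∧ Y = g * t) ∧
      ∃ g, Odd g ∧ R = g * s ∧ X = g * t := by
  -- With `s : t` equal to `K : Z` in lowest terms, each proportional pair is an integer multiple of
  -- `(s, t)`, and an odd member makes the multiplier odd.
  obtain ⟨g, s, t, hg, hco, hs, ht⟩ :=
    Nat.exists_coprime' (m := K) (n := Z) (Nat.gcd_pos_of_pos_left _ hK)
  have hs0 : 0 < s := Nat.pos_of_ne_zero (by rintro rfl; omega)
  have aux (Q W : ℕ) (h : Z * Q = W * K) : ∃ g', Q = g' * s ∧ W = g' * t := by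
    have h' : t * Q = W * s := by
      refine Nat.eq_of_mul_eq_mul_right hg ?_
      rw [hs, ht] at h
      linarith
    obtain ⟨g', rfl⟩ : s ∣ Q := hco.dvd_of_dvd_mul_left (h' ▸ dvd_mul_left s W)
    refine ⟨g', mul_comm _ _, Nat.eq_of_mul_eq_mul_right hs0 ?_⟩
    linarith
  have odd (g Q W : ℕ) (h : Odd Q ∨ Odd W) (hQ : Q = g * s) (hW : W = g * t) : Odd g := by
    rcases h with h | h
    · exact Nat.Odd.of_mul_left (hQ ▸ h)
    · exact Nat.Odd.of_mul_left (hW ▸ h)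
  obtain ⟨g₁, h₃, h₄⟩ := aux P Y h₁
  obtain ⟨g₂, h₅, h₆⟩ := aux R X h₂
  have hs' : K = g * s := by rw [hs, mul_comm]
  have ht' : Z = g * t := by rw [ht, mul_comm]
  exact ⟨s, t, ⟨g, odd g K Z (by tauto) hs' ht', hs', ht'⟩,
    ⟨g₁, odd g₁ P Y (by tauto) h₃ h₄, h₃, h₄⟩, g₂, odd g₂ R X (by tauto) h₅ h₆, h₅, h₆⟩

theorem mul_eq_mul_of_proportional {K P Y Z : ℕ} {x y : ℤ} (hx : x ≠ 0) (hy : y ≠ 0)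
    (h₁ : (K : ℤ) * x = Z * y) (h₂ : (P : ℤ) * x = Y * y) : Z * P = Y * K := by
  have h : (x * y) * ((Z : ℤ) * P) = (x * y) * (Y * K) := by
    linear_combination (-(Y * y)) * h₁ + (Z * y) * h₂
  exact_mod_cast mul_left_cancel₀ (mul_ne_zero hx hy) h

end Arithmetic

/-! ### The six-block matrix and the main theorem -/

/-- The coarse block of one of the six blocks. -/
def coarseIndex : Fin 6 → Fin 3 := ![0, 0, 1, 1, 2, 2]

/-- The sign attached to one of the six blocks. -/
def fineSign : Fin 6 → ℤ := ![1, -1, 1, -1, 1, -1]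

theorem fineSign_values (i : Fin 6) : fineSign i = 1 ∨ fineSign i = -1 := by
  revert i; decide

theorem signPatternM5_eq (i j : Fin 6) :
    signPatternM5 i j = fineSign i * fineSign j * coarsePattern (coarseIndex i) (coarseIndex j) := by
  fin_cases i <;> fin_cases j <;> rfl

theorem card_coarse_block (w : Fin 6 → ℕ) (r : Fin 3) :
    (Finset.univ.filter fun z : BlockIndex w => coarseIndex z.1 = r).card =
      ![w 0 + w 1, w 2 + w 3, w 4 + w 5] r := by
  rw [Finset.card_filter, Fintype.sum_sigma]
  fin_cases r <;> simp [Fin.sum_univ_six, coarseIndex]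

theorem coarseIndex_surjective (w : Fin 6 → ℕ)
    (h : ∀ r, 0 < (![w 0 + w 1, w 2 + w 3, w 4 + w 5] : Fin 3 → ℕ) r) :
    Function.Surjective fun z : BlockIndex w => coarseIndex z.1 := by
  intro r
  have h0 := h r
  rw [← card_coarse_block, Finset.card_pos] at h0
  obtain ⟨z, hz⟩ := h0
  exact ⟨z, by simpa using hz⟩

theorem forall_fin_three {P : Fin 3 → Prop} (h₀ : P 0) (h₁ : P 1) (h₂ : P 2) (t : Fin 3) :
    P t := by
  fin_cases t <;> assumption

theorem mainTheorem7 (k l p q r s a b c d e f : ℕ)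
    (hab : 0 < a + b) (hcd : 0 < c + d) (hef : 0 < e + f)
    (hkl : 0 < k + l) (hpq : 0 < p + q) (hrs : 0 < r + s)
    (hrow : matrixM5 k l p q r s a b c d e f *ᵥ 1 = 0)
    (hcol : 1 ᵥ* matrixM5 k l p q r s a b c d e f = 0) :
    IsRealizable (matrixM5 k l p q r s a b c d e f) ↔
      (Even (a + b) ∧ Even (c + d) ∧ Even (e + f) ∧
          Even (k + l) ∧ Even (p + q) ∧ Even (r + s)) ∨
        (((Odd (a + b) ∧ Odd (c + d) ∧ Odd (e + f)) ∨
            (Odd (k + l) ∧ Odd (p + q) ∧ Odd (r + s))) ∧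
          ((e : ℚ) + f) / ((k : ℚ) + l) = ((c : ℚ) + d) / ((p : ℚ) + q) ∧
          ((c : ℚ) + d) / ((p : ℚ) + q) = ((a : ℚ) + b) / ((r : ℚ) + s)) := by
  have hρ := coarseIndex_surjective ![k, l, p, q, r, s]
    (fun t => by fin_cases t <;> assumption)
  have hσ := coarseIndex_surjective ![a, b, c, d, e, f]
    (fun t => by fin_cases t <;> assumption)
  rw [isRealizable_iff_exists_isSignBlock (E := matrixM5 k l p q r s a b c d e f) hρ hσ (fun i => fineSign_values i.1)
    (fun j => fineSign_values j.1) (fun i j => signPatternM5_eq i.1 j.1) hrow hcol]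
  have cr := card_coarse_block ![k, l, p, q, r, s]
  have cc := card_coarse_block ![a, b, c, d, e, f]
  have cK := cr 0
  have cP := cr 1
  have cR := cr 2
  have cX := cc 0
  have cY := cc 1
  have cZ := cc 2
  simp only [Matrix.cons_val] at cK cP cR cX cY cZ
  have hdiv : (((e : ℚ) + f) / ((k : ℚ) + l) = ((c : ℚ) + d) / ((p : ℚ) + q) ∧
      ((c : ℚ) + d) / ((p : ℚ) + q) = ((a : ℚ) + b) / ((r : ℚ) + s)) ↔
      (e + f) * (p + q) = (c + d) * (k + l) ∧ (c + d) * (r + s) = (a + b) * (p + q) := by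
    have h1 : (k : ℚ) + l ≠ 0 := by exact_mod_cast hkl.ne'
    have h2 : (p : ℚ) + q ≠ 0 := by exact_mod_cast hpq.ne'
    have h3 : (r : ℚ) + s ≠ 0 := by exact_mod_cast hrs.ne'
    rw [div_eq_div_iff h1 h2, div_eq_div_iff h2 h3]
    norm_cast
  rw [hdiv]
  have r0 : Fin.rev (0 : Fin 3) = 2 := rfl
  have r1 : Fin.rev (1 : Fin 3) = 1 := rfl
  have r2 : Fin.rev (2 : Fin 3) = 0 := rfl
  constructor
  · rintro ⟨x, y, h⟩
    obtain ⟨⟨G₀, h₀⟩, ⟨G₁, h₁⟩, ⟨G₂, h₂⟩⟩ := And.intro (h 0) (And.intro (h 1) (h 2))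
    rw [r0] at h₀
    rw [r1] at h₁
    rw [r2] at h₂
    have x₀ := h₀.even_row_iff (by omega)
    have x₁ := h₁.even_row_iff (by omega)
    have x₂ := h₂.even_row_iff (by omega)
    have y₀ := h₀.even_col_iff (by omega)
    have y₁ := h₁.even_col_iff (by omega)
    have y₂ := h₂.even_col_iff (by omega)
    have e₀ := h₀.card_mul_eq
    have e₁ := h₁.card_mul_eq
    have e₂ := h₂.card_mul_eq
    rw [cZ] at x₀
    rw [cY] at x₁
    rw [cX] at x₂
    rw [cK] at y₀
    rw [cP] at y₁
    rw [cR] at y₂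
    rw [cK, cZ] at e₀
    rw [cP, cY] at e₁
    rw [cR, cX] at e₂
    by_cases hxy : Even x ∧ Even y
    · exact Or.inl ⟨x₂.1 hxy.1, x₁.1 hxy.1, x₀.1 hxy.1, y₀.1 hxy.2, y₁.1 hxy.2, y₂.1 hxy.2⟩
    -- One of `x`, `y` is odd, hence nonzero; by the double count they vanish together, so neither
    -- is zero.
    · have hiff : x = 0 ↔ y = 0 := by
        have hK : ((k + l : ℕ) : ℤ) ≠ 0 := by exact_mod_cast hkl.ne'
        have hZ : ((e + f : ℕ) : ℤ) ≠ 0 := by exact_mod_cast hef.ne'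
        constructor <;> rintro rfl
        · simpa only [mul_zero, zero_eq_mul, hZ, false_or] using e₀
        · simpa only [mul_zero, mul_eq_zero, hK, false_or] using e₀
      have hx : x ≠ 0 := fun h => hxy (by simp [h, hiff.1 h])
      have hy : y ≠ 0 := fun h => hx (hiff.2 h)
      refine Or.inr ⟨?_, mul_eq_mul_of_proportional hx hy e₀ e₁,
        mul_eq_mul_of_proportional hx hy e₁ e₂⟩
      simp only [← Nat.not_even_iff_odd, ← x₀, ← x₁, ← x₂, ← y₀, ← y₁, ← y₂]
      exact (not_and_or.1 hxy).imp (fun h => ⟨h, h, h⟩) fun h => ⟨h, h, h⟩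
  · rintro (⟨hX, hY, hZ, hK, hP, hR⟩ | ⟨hodd, h₁, h₂⟩)
    · refine ⟨0, 0, fun t => exists_isSignBlock_zero ?_ ?_⟩
      · rw [cr]; fin_cases t <;> simpa using ‹_›
      · rw [cc]; fin_cases t <;> simpa [r0, r1, r2] using ‹_›
    · have h₃ : (e + f) * (r + s) = (a + b) * (k + l) := by
        refine Nat.eq_of_mul_eq_mul_right hcd ?_
        refine Nat.eq_of_mul_eq_mul_right hpq ?_
        calc (e + f) * (r + s) * (c + d) * (p + q)
            = ((e + f) * (p + q)) * ((c + d) * (r + s)) := by ring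
          _ = _ := by rw [h₁, h₂]; ring
      obtain ⟨s', t', ⟨g₀, o₀, k₀, z₀⟩, ⟨g₁, o₁, k₁, z₁⟩, ⟨g₂, o₂, k₂, z₂⟩⟩ :=
        exists_odd_multiples hkl hodd h₁ h₃
      -- The swap is due to inflation: row sums come from the widths `t'`, column sums from the
      -- heights `s'`.
      refine ⟨t', s', forall_fin_three ?_ ?_ ?_⟩
      · rw [r0]
        exact exists_isSignBlock_of_odd o₀ (cK.trans k₀) (cZ.trans z₀)
      · rw [r1]
        exact exists_isSignBlock_of_odd o₁ (cP.trans k₁) (cY.trans z₁)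
      · rw [r2]
        exact exists_isSignBlock_of_odd o₂ (cR.trans k₂) (cX.trans z₂)
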